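/- Let $k \ge 8$ be an integer and let $G$ be a finite simple connected $k$-regular graph which is equiarboreal, i.e. the number of spanning trees of $G$ containing a given edge is the same for all edges of $G$. An edge cut of $G$ is a set $C$ of edges consisting of all edges between $A$ and $B$, where $(A,B)$ is a partition of $V(G)$ into two nonempty parts; it is called non-trivial if $|A|\ge 2$ and $|B|\ge 2$, and trivial otherwise. Let $\lambda(G)$ denote the edge-connectivity of $G$, i.e. the minimum number of edges in an edge cut of $G$. Then: 1. $\lambda(G) = k$. 2. If $k \ge 11$, then every edge cut $C$ of $G$ with $|C| = k$ is trivial. 3. Every non-trivial edge cut $C$ of $G$ with $|C| \le k$ satisfies $|C| \ge 2\lfloor k-\sqrt{k}\rfloor - 2$. -/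

import Mathlib

namespace SimpleGraph

/-- The set of spanning trees of `G`: a spanning subgraph of `G` is given by its adjacency relation
on the whole vertex type `V`. -/
def spanningTrees {V : Type*} (G : SimpleGraph V) : Set (SimpleGraph V) :=
  {T | T ≤ G ∧ T.IsTree}

/-- `G` is equiarboreal: the number of spanning trees of `G` containing a given edge of `G` does not
depend on the choice of the edge. -/
def IsEquiarboreal {V : Type*} (G : SimpleGraph V) : Prop :=
  ∀ e ∈ G.edgeSet, ∀ f ∈ G.edgeSet,
    {T ∈ G.spanningTrees | e ∈ T.edgeSet}.ncard = {T ∈ G.spanningTrees | f ∈ T.edgeSet}.ncard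

/-- The set of edges of `G` between `A` and its complement. -/
def edgeCut {V : Type*} (G : SimpleGraph V) (A : Set V) : Set (Sym2 V) :=
  {e | ∃ u ∈ A, ∃ v ∈ Aᶜ, G.Adj u v ∧ e = s(u, v)}

/-- `C` is an edge cut of `G`: the set of all edges between the two parts of a partition of the
vertices into two nonempty parts. -/
def IsEdgeCut {V : Type*} (G : SimpleGraph V) (C : Set (Sym2 V)) : Prop :=
  ∃ A : Set V, A.Nonempty ∧ Aᶜ.Nonempty ∧ C = G.edgeCut A

/-- `C` is a non-trivial edge cut of `G`: both parts of the partition have at least two vertices. -/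
def IsNontrivialEdgeCut {V : Type*} (G : SimpleGraph V) (C : Set (Sym2 V)) : Prop :=
  ∃ A : Set V, A.Nontrivial ∧ Aᶜ.Nontrivial ∧ C = G.edgeCut A

/-- The edge-connectivity of a finite graph with at least two vertices: the minimum number of edges
in an edge cut. -/
noncomputable def edgeConnectivity {V : Type*} (G : SimpleGraph V) : ℕ :=
  sInf {n | ∃ C : Set (Sym2 V), G.IsEdgeCut C ∧ C.ncard = n}

end SimpleGraph

/-!
Let `τ` be the number of spanning trees of `G` and `τ_e` the number of those which contain the
edge `e`, so that `τ_e / τ` is the effective resistance across `e` when all edges are unit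
resistors. Counting the edges of all spanning trees (Foster's theorem,
`IsEquiarboreal.card_mul_ncard`) shows that in an equiarboreal `k`-regular graph on `n` vertices
every edge has resistance `2 (n - 1) / (n k) < 2 / k`. By the Dirichlet principle, every function `f`
then satisfies `k (f u - f v) ^ 2 < 2 E(f)` across every edge `uv` with `f u ≠ f v`, where `E(f)` is
the sum of the squared differences of `f` over all edges (`IsEquiarboreal.mul_sq_lt_dirichletForm`).

The Dirichlet principle is proved combinatorially. The potential of the current from `u` to `v`
counts the two-component spanning forests separating `u` from `v` in which a given vertex is on the
side of `u`. Adding an edge between the two components turns pairs (forest, crossing edge) into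
pairs (tree, edge on its `u`-`v` path) (`ncard_separatingForest_eq`), and differences of a function
along a path telescope. This computes the Laplacian of the potential
(`dirichletForm_forestPotential`), and the Cauchy-Schwarz inequality does the rest.

Let `C` be the cut between `A` and its complement, `c = |C|`. The function `±1` on the two sides
shows `k < 2 c`. A nontrivial cut is not a star: moving the centre of the star to the other side
would give a cut with at most `k - c` edges, and both cuts have more than `k / 2`. So a nontrivial
cut has two disjoint edges. For an edge `uv` of `C`, let `s` be the number of edges of `C` at `u`
plus the number at `v`. The function which is `±1` at `u`, `v` and `±β` on the rest of the two
sides, with the optimal `β`, gives `(k + 1 - s) ^ 2 < 2 (c - s) + k + 1`, and hence `s > k - √k` if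
`c ≤ k`. Adding this up for two disjoint edges, where at most four edges of `C` are counted twice,
gives `c ≥ 2 (⌊k - √k⌋ + 1) - 4`. For `k ≥ 8` this bound is at least `k`, for `k ≥ 11` it is more
than `k`, and trivial cuts have exactly `k` edges.
-/

namespace SimpleGraph

variable {V : Type*} {G T F : SimpleGraph V} {u v x y : V} {A : Set V} {k : ℕ}

/-! ### Two-component spanning forests -/

/-- `F` is a spanning forest of `G` with exactly two components, one containing `u` and the other
containing `v`. -/
def IsSeparatingForest (G : SimpleGraph V) (u v : V) (F : SimpleGraph V) : Prop :=
  F ≤ G ∧ F.IsAcyclic ∧ (∀ w, F.Reachable u w ∨ F.Reachable v w) ∧ ¬ F.Reachable u v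

theorem IsSeparatingForest.not_reachable (hF : G.IsSeparatingForest u v F) (hx : F.Reachable u x)
    (hy : F.Reachable v y) : ¬ F.Reachable x y :=
  fun h => hF.2.2.2 (hx.trans (h.trans hy.symm))

theorem IsSeparatingForest.sup_edge_mem_spanningTrees (hF : G.IsSeparatingForest u v F)
    (hxy : G.Adj x y) (hx : F.Reachable u x) (hy : F.Reachable v y) :
    F ⊔ edge x y ∈ G.spanningTrees := by
  have hn := hF.not_reachable hx hy
  refine ⟨sup_le hF.1 ((edge_le_iff _).2 (Or.inr hxy)), ?_, hF.2.1.sup_edge_of_not_reachable hn⟩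
  have hle : F ≤ F ⊔ edge x y := le_sup_left
  have hyx : (F ⊔ edge x y).Reachable y x :=
    Adj.reachable (Or.inr ((edge_adj ..).2 ⟨Or.inr ⟨rfl, rfl⟩, hxy.ne.symm⟩))
  rw [connected_iff_exists_forall_reachable]
  refine ⟨u, fun w => ?_⟩
  rcases hF.2.2.1 w with h | h
  · exact h.mono hle
  · exact (hx.mono hle).trans (hyx.symm.trans ((hy.symm.trans h).mono hle))

theorem deleteEdges_sup_edge (h : ¬ F.Adj x y) : (F ⊔ edge x y).deleteEdges {s(x, y)} = F := by
  ext a b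
  simp only [deleteEdges_adj, sup_adj, adj_edge, Set.mem_singleton_iff]
  constructor
  · rintro ⟨h1 | h1, h2⟩
    · exact h1
    · exact absurd h1.1.symm h2
  · refine fun hab => ⟨Or.inl hab, fun he => h ?_⟩
    rw [← mem_edgeSet, ← he]
    exact hab

theorem deleteEdges_sup_edge_of_adj (h : T.Adj x y) : T.deleteEdges {s(x, y)} ⊔ edge x y = T := by
  ext a b
  simp only [deleteEdges_adj, sup_adj, adj_edge, Set.mem_singleton_iff]
  constructor
  · rintro (h1 | h1)
    · exact h1.1
    · rw [← mem_edgeSet, ← h1.1]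
      exact h
  · intro hab
    by_cases he : s(a, b) = s(x, y)
    · exact Or.inr ⟨he.symm, hab.ne⟩
    · exact Or.inl ⟨hab, he⟩

/-- Deleting an edge from a connected graph leaves every vertex connected to one of its ends. -/
theorem Connected.reachable_deleteEdges_or (hT : T.Connected) (x y w : V) :
    (T.deleteEdges {s(x, y)}).Reachable x w ∨ (T.deleteEdges {s(x, y)}).Reachable y w := by
  classical
  obtain ⟨p⟩ := hT x w
  by_contra! h
  obtain ⟨d, -, h1, h2⟩ := p.exists_boundary_dart
    {w | (T.deleteEdges {s(x, y)}).Reachable x w ∨ (T.deleteEdges {s(x, y)}).Reachable y w}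
    (Or.inl (Reachable.refl x)) (fun h' => h'.elim h.1 h.2)
  by_cases he : s(d.fst, d.snd) = s(x, y)
  · apply h2
    rcases Sym2.eq_iff.1 he with ⟨-, h3⟩ | ⟨-, h3⟩ <;> rw [h3]
    · exact Or.inr (Reachable.refl _)
    · exact Or.inl (Reachable.refl _)
  · have ha : (T.deleteEdges {s(x, y)}).Reachable d.fst d.snd :=
      Adj.reachable (deleteEdges_adj.2 ⟨d.adj, he⟩)
    exact h2 (h1.imp (·.trans ha) (·.trans ha))

theorem isSeparatingForest_deleteEdges (hT : T ∈ G.spanningTrees) (hxy : T.Adj x y)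
    (hx : (T.deleteEdges {s(x, y)}).Reachable u x) (hy : (T.deleteEdges {s(x, y)}).Reachable v y) :
    G.IsSeparatingForest u v (T.deleteEdges {s(x, y)}) := by
  have hle : T.deleteEdges {s(x, y)} ≤ T := deleteEdges_le _
  refine ⟨hle.trans hT.1, hT.2.isAcyclic.anti hle, fun w => ?_, fun h => ?_⟩
  · exact (hT.2.connected.reachable_deleteEdges_or x y w).imp hx.trans hy.trans
  · exact isAcyclic_iff_forall_adj_isBridge.1 hT.2.isAcyclic hxy (hx.symm.trans (h.trans hy))

/-! ### Paths in trees and edge exchange -/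

/-- The edge `xy` lies on the path of the tree `T` from `u` to `v`, and is traversed from `x`
to `y`: deleting it leaves `u` connected to `x` and `v` connected to `y`. -/
def TraversesOn (T : SimpleGraph V) (u v x y : V) : Prop :=
  T.Adj x y ∧ (T.deleteEdges {s(x, y)}).Reachable u x ∧ (T.deleteEdges {s(x, y)}).Reachable v y

/-- Exchanging the edge `xy` for the separation of `u` from `v`: adding `xy` to a forest in which
`u` and `v` are separated, with `x` on the side of `u` and `y` on the side of `v`, gives a tree whose
`u`-`v` path traverses `xy`, and every such tree arises exactly once. -/
theorem ncard_separatingForest_eq (hxy : G.Adj x y) :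
    {F | G.IsSeparatingForest u v F ∧ F.Reachable u x ∧ F.Reachable v y}.ncard =
      {T | T ∈ G.spanningTrees ∧ T.TraversesOn u v x y}.ncard := by
  refine Set.ncard_congr (fun F _ => F ⊔ edge x y) ?_ ?_ ?_
  · rintro F ⟨hF, hx, hy⟩
    have hn : ¬ F.Adj x y := fun h => hF.not_reachable hx hy h.reachable
    refine ⟨hF.sup_edge_mem_spanningTrees hxy hx hy, ?_⟩
    rw [TraversesOn, deleteEdges_sup_edge hn]
    exact ⟨Or.inr ((edge_adj ..).2 ⟨Or.inl ⟨rfl, rfl⟩, hxy.ne⟩), hx, hy⟩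
  · rintro F F' ⟨hF, hx, hy⟩ ⟨hF', hx', hy'⟩ h
    rw [← deleteEdges_sup_edge (fun h => hF.not_reachable hx hy h.reachable), h,
      deleteEdges_sup_edge (fun h => hF'.not_reachable hx' hy' h.reachable)]
  · rintro T ⟨hT, hxyT, hx, hy⟩
    exact ⟨_, ⟨isSeparatingForest_deleteEdges hT hxyT hx hy, hx, hy⟩,
      deleteEdges_sup_edge_of_adj hxyT⟩

theorem Walk.exists_edges_eq_of_mem_darts (p : G.Walk u v) {d : G.Dart} (hd : d ∈ p.darts) :
    ∃ (q : G.Walk u d.fst) (r : G.Walk d.snd v), p.edges = q.edges ++ d.edge :: r.edges := by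
  induction p with
  | nil => simp at hd
  | cons h p ih =>
    rw [darts_cons, List.mem_cons] at hd
    rcases hd with rfl | hd
    · exact ⟨nil, p, by simp [Dart.edge]⟩
    · obtain ⟨q, r, e⟩ := ih hd
      exact ⟨cons h q, r, by simp [e]⟩

theorem Walk.sum_darts (f : V → ℝ) (p : G.Walk u v) :
    (p.darts.map fun d => f d.fst - f d.snd).sum = f u - f v := by
  induction p with
  | nil => simp
  | cons h p ih => simp [ih]

/-- A path in a tree traverses an edge exactly if deleting that edge separates the ends of the path
accordingly. -/
theorem IsTree.mem_darts_iff (hT : T.IsTree) {p : T.Walk u v} (hp : p.IsPath) (d : T.Dart) :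
    d ∈ p.darts ↔ T.TraversesOn u v d.fst d.snd := by
  constructor
  · intro hd
    obtain ⟨q, r, e⟩ := p.exists_edges_eq_of_mem_darts hd
    have hnd := hp.isTrail.edges_nodup
    rw [e, List.nodup_append, List.nodup_cons] at hnd
    obtain ⟨-, ⟨hr, -⟩, hq⟩ := hnd
    refine ⟨d.adj, reachable_deleteEdges_iff_exists_walk.2 ⟨q, fun h => ?_⟩,
      reachable_deleteEdges_iff_exists_walk.2 ⟨r.reverse, fun h => ?_⟩⟩
    · exact hq _ h _ (List.mem_cons_self ..) rfl
    · rw [Walk.edges_reverse, List.mem_reverse] at h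
      exact hr h
  · rintro ⟨hadj, hx, hy⟩
    have hb : ¬ (T.deleteEdges {s(d.fst, d.snd)}).Reachable d.fst d.snd :=
      isAcyclic_iff_forall_adj_isBridge.1 hT.isAcyclic hadj
    have hmem : s(d.fst, d.snd) ∈ p.edges :=
      p.mem_edges_of_not_reachable_deleteEdges fun h => hb (hx.symm.trans (h.trans hy))
    obtain ⟨d', hd', he⟩ := List.mem_map.1 hmem
    rcases dart_edge_eq_iff d' d |>.1 he with rfl | rfl
    · exact hd'
    · -- traversal in the opposite direction would connect `u` to both ends of the bridge
      obtain ⟨q, r, e⟩ := p.exists_edges_eq_of_mem_darts hd'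
      have hnd := hp.isTrail.edges_nodup
      rw [e, List.nodup_append] at hnd
      refine absurd (hx.symm.trans (reachable_deleteEdges_iff_exists_walk.2 ⟨q, fun h => ?_⟩)) hb
      exact hnd.2.2 _ h _ (List.mem_cons_self ..) (by rw [Dart.edge_symm]; rfl)

open Classical in
/-- The differences of `f` along the path of a tree from `u` to `v` telescope. -/
theorem IsTree.sum_traversesOn [Fintype V] (hT : T.IsTree) (u v : V) (f : V → ℝ) :
    ∑ x, ∑ y, (if T.TraversesOn u v x y then f x - f y else 0) = f u - f v := by
  obtain ⟨p, hp⟩ := hT.connected.exists_isPath u v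
  have hnd : (p.darts.map Dart.toProd).Nodup :=
    (p.darts_nodup_of_support_nodup hp.support_nodup).map Dart.toProd_injective
  have hfin : Finset.univ.filter (fun q : V × V => T.TraversesOn u v q.1 q.2) =
      (p.darts.map Dart.toProd).toFinset := by
    ext ⟨x, y⟩
    simp only [Finset.mem_filter, Finset.mem_univ, true_and, List.mem_toFinset, List.mem_map]
    constructor
    · exact fun h => ⟨⟨(x, y), h.1⟩, (hT.mem_darts_iff hp _).2 h, rfl⟩
    · rintro ⟨d, hd, he⟩
      have := (hT.mem_darts_iff hp d).1 hd
      rwa [he] at this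
  rw [← Fintype.sum_prod_type', ← Finset.sum_filter, hfin, List.sum_toFinset _ hnd, List.map_map]
  exact p.sum_darts f

/-! ### The Dirichlet principle -/

open Classical in
theorem ncard_setOf_eq_sum {α : Type*} [Fintype α] (P : α → Prop) :
    ({a | P a}.ncard : ℝ) = ∑ a, if P a then 1 else 0 := by
  rw [Set.ncard_eq_toFinset_card', Finset.sum_boole, Set.toFinset_ofPred]

open Classical in
/-- The Dirichlet form of `G` with unit conductances. The sum runs over ordered pairs of adjacent
vertices, so that every edge is counted twice. -/
noncomputable def dirichletForm [Fintype V] (G : SimpleGraph V) (f g : V → ℝ) : ℝ :=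
  ∑ x, ∑ y, if G.Adj x y then (f x - f y) * (g x - g y) else 0

theorem dirichletForm_sq_le [Fintype V] (G : SimpleGraph V) (f g : V → ℝ) :
    G.dirichletForm f g ^ 2 ≤ G.dirichletForm f f * G.dirichletForm g g := by
  classical
  have h : ∀ f g : V → ℝ, G.dirichletForm f g =
      ∑ q : V × V with G.Adj q.1 q.2, (f q.1 - f q.2) * (g q.1 - g q.2) := fun f g => by
    rw [Finset.sum_filter, Fintype.sum_prod_type, dirichletForm]
  simp only [h, ← sq]
  exact Finset.sum_mul_sq_le_sq_mul_sq _ _ _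

/-- The potential of the unit current from `u` to `v`, scaled by the number of spanning trees:
the number of two-component forests separating `u` from `v` with `x` on the side of `u`. -/
noncomputable def forestPotential (G : SimpleGraph V) (u v x : V) : ℝ :=
  {F | G.IsSeparatingForest u v F ∧ F.Reachable u x}.ncard

theorem IsSeparatingForest.reachable_iff_not (hF : G.IsSeparatingForest u v F) (x : V) :
    F.Reachable v x ↔ ¬ F.Reachable u x :=
  ⟨fun h h' => hF.2.2.2 (h'.trans h.symm), (hF.2.2.1 x).resolve_left⟩

theorem forestPotential_sub [Fintype V] (G : SimpleGraph V) (u v x y : V) :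
    G.forestPotential u v x - G.forestPotential u v y =
      {F | G.IsSeparatingForest u v F ∧ F.Reachable u x ∧ F.Reachable v y}.ncard -
      {F | G.IsSeparatingForest u v F ∧ F.Reachable u y ∧ F.Reachable v x}.ncard := by
  classical
  simp only [forestPotential, ncard_setOf_eq_sum]
  rw [← Finset.sum_sub_distrib, ← Finset.sum_sub_distrib]
  refine Finset.sum_congr rfl fun F _ => ?_
  by_cases hF : G.IsSeparatingForest u v F
  · simp only [hF, true_and, hF.reachable_iff_not]
    by_cases hx : F.Reachable u x <;> by_cases hy : F.Reachable u y <;> simp [hx, hy]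
  · simp [hF]

theorem forestPotential_sub_self [Fintype V] (huv : G.Adj u v) :
    G.forestPotential u v u - G.forestPotential u v v =
      {T ∈ G.spanningTrees | s(u, v) ∈ T.edgeSet}.ncard := by
  have h : {F | G.IsSeparatingForest u v F ∧ F.Reachable u v ∧ F.Reachable v u} = ∅ :=
    Set.eq_empty_of_forall_notMem fun F hF => hF.1.2.2.2 hF.2.1
  rw [forestPotential_sub, h, ncard_separatingForest_eq huv, Set.ncard_empty, Nat.cast_zero,
    sub_zero]
  congr 2
  ext T
  exact and_congr_right fun _ => ⟨fun h => h.1, fun h => ⟨h, Reachable.refl _, Reachable.refl _⟩⟩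

open Classical in
/-- Every spanning tree contributes the telescoping sum along its path from `u` to `v`. -/
theorem sum_ncard_separatingForest_mul [Fintype V] (G : SimpleGraph V) (u v : V) (f : V → ℝ) :
    ∑ x, ∑ y, (if G.Adj x y then
      ({F | G.IsSeparatingForest u v F ∧ F.Reachable u x ∧ F.Reachable v y}.ncard : ℝ) *
        (f x - f y) else 0) = G.spanningTrees.ncard * (f u - f v) := by
  have h1 : ∀ x y, (if G.Adj x y then
      ({F | G.IsSeparatingForest u v F ∧ F.Reachable u x ∧ F.Reachable v y}.ncard : ℝ) *
        (f x - f y) else 0) = ∑ T : SimpleGraph V, if T ∈ G.spanningTrees then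
          (if T.TraversesOn u v x y then f x - f y else 0) else 0 := by
    intro x y
    split_ifs with hxy
    · rw [ncard_separatingForest_eq hxy, ncard_setOf_eq_sum, Finset.sum_mul]
      simp only [ite_mul, one_mul, zero_mul, ite_and]
    · refine (Finset.sum_eq_zero fun T _ => ?_).symm
      split_ifs with hT hxyT
      · exact absurd (hT.1 hxyT.1) hxy
      · rfl
      · rfl
  have h2 : (G.spanningTrees.ncard : ℝ) = ∑ T : SimpleGraph V,
      if T ∈ G.spanningTrees then 1 else 0 := ncard_setOf_eq_sum (· ∈ G.spanningTrees)
  simp only [h1, h2, Finset.sum_mul]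
  have h3 : ∀ x, ∑ y, ∑ T : SimpleGraph V, (if T ∈ G.spanningTrees then
      (if T.TraversesOn u v x y then f x - f y else 0) else 0) =
      ∑ T : SimpleGraph V, ∑ y, (if T ∈ G.spanningTrees then
      (if T.TraversesOn u v x y then f x - f y else 0) else 0) := fun x => Finset.sum_comm
  simp only [h3]
  rw [Finset.sum_comm]
  refine Finset.sum_congr rfl fun T _ => ?_
  by_cases hT : T ∈ G.spanningTrees
  · simp only [hT, if_true, one_mul]
    exact hT.2.sum_traversesOn u v f
  · simp [hT]

/-- Kirchhoff's theorem in weak form: the Laplacian of the forest potential is the number of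
spanning trees times the difference of the unit masses at `u` and `v`. -/
theorem dirichletForm_forestPotential [Fintype V] (G : SimpleGraph V) (u v : V) (f : V → ℝ) :
    G.dirichletForm (G.forestPotential u v) f = 2 * (G.spanningTrees.ncard * (f u - f v)) := by
  classical
  have h := sum_ncard_separatingForest_mul G u v f
  rw [two_mul]
  nth_rewrite 1 [← h]
  rw [← h, dirichletForm]
  nth_rewrite 3 [Finset.sum_comm]
  simp only [← Finset.sum_add_distrib]
  refine Finset.sum_congr rfl fun x _ => Finset.sum_congr rfl fun y _ => ?_
  rw [forestPotential_sub, G.adj_comm y x]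
  split_ifs
  · ring
  · simp

/-- The Dirichlet principle, with the effective resistance between the ends of an edge expressed by
the proportion of spanning trees which contain it. -/
theorem two_mul_ncard_spanningTrees_mul_sq_le [Fintype V] (hG : G.Connected) (huv : G.Adj u v)
    (f : V → ℝ) :
    2 * G.spanningTrees.ncard * (f u - f v) ^ 2 ≤
      {T ∈ G.spanningTrees | s(u, v) ∈ T.edgeSet}.ncard * G.dirichletForm f f := by
  have hpos : (0 : ℝ) < G.spanningTrees.ncard := by
    obtain ⟨T, hT⟩ := hG.exists_isTree_le
    exact_mod_cast (Set.ncard_pos (Set.toFinite _)).2 ⟨T, hT⟩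
  have h := G.dirichletForm_sq_le (G.forestPotential u v) f
  rw [dirichletForm_forestPotential, dirichletForm_forestPotential,
    forestPotential_sub_self huv] at h
  refine le_of_mul_le_mul_left ?_ (mul_pos two_pos hpos)
  linarith

/-! ### Foster's theorem and the resistance bound -/

theorem sum_adj_eq [Fintype V] [DecidableRel G.Adj] {k : ℕ} (hreg : G.IsRegularOfDegree k) (x : V) :
    ∑ y, (if G.Adj x y then (1 : ℝ) else 0) = k := by
  rw [Finset.sum_boole, ← hreg x, ← card_neighborFinset_eq_degree, neighborFinset_eq_filter]

/-- Foster's theorem for equiarboreal regular graphs: summing over all edges counts every spanning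
tree once for each of its `n - 1` edges. -/
theorem IsEquiarboreal.card_mul_ncard [Fintype V] [DecidableRel G.Adj] {k : ℕ}
    (hreg : G.IsRegularOfDegree k) (heq : G.IsEquiarboreal) (huv : G.Adj u v) :
    (Fintype.card V : ℝ) * (k * {T ∈ G.spanningTrees | s(u, v) ∈ T.edgeSet}.ncard) =
      2 * (Fintype.card V - 1) * G.spanningTrees.ncard := by
  classical
  set t : ℝ := (({T ∈ G.spanningTrees | s(u, v) ∈ T.edgeSet}.ncard : ℕ) : ℝ) with ht
  have h1 : ∀ x y, (if G.Adj x y then (1 : ℝ) else 0) * t =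
      ∑ T : SimpleGraph V, if T ∈ G.spanningTrees then (if T.Adj x y then (1 : ℝ) else 0) else 0 := by
    intro x y
    split_ifs with hxy
    · rw [one_mul, ht, heq _ huv s(x, y) hxy, ncard_setOf_eq_sum]
      simp only [ite_and, mem_edgeSet]
    · rw [zero_mul]
      refine (Finset.sum_eq_zero fun T _ => ?_).symm
      split_ifs with hT hxyT
      · exact absurd (hT.1 hxyT) hxy
      · rfl
      · rfl
  have h2 : (G.spanningTrees.ncard : ℝ) = ∑ T : SimpleGraph V,
      if T ∈ G.spanningTrees then 1 else 0 := ncard_setOf_eq_sum (· ∈ G.spanningTrees)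
  have h3 : (Fintype.card V : ℝ) * (k * t) = ∑ x, ∑ y, (if G.Adj x y then (1 : ℝ) else 0) * t := by
    simp only [← Finset.sum_mul, sum_adj_eq hreg]
    simp [mul_assoc]
  rw [h3, h2, Finset.mul_sum]
  simp only [h1]
  have h4 : ∀ x, ∑ y, ∑ T : SimpleGraph V, (if T ∈ G.spanningTrees then
      (if T.Adj x y then (1 : ℝ) else 0) else 0) =
      ∑ T : SimpleGraph V, ∑ y, (if T ∈ G.spanningTrees then
      (if T.Adj x y then (1 : ℝ) else 0) else 0) := fun x => Finset.sum_comm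
  simp only [h4]
  rw [Finset.sum_comm]
  refine Finset.sum_congr rfl fun T _ => ?_
  by_cases hT : T ∈ G.spanningTrees
  · have h5 : ∀ x, ∑ y, (if T.Adj x y then (1 : ℝ) else 0) = T.degree x := fun x => by
      rw [Finset.sum_boole, ← card_neighborFinset_eq_degree, neighborFinset_eq_filter]
    have h6 : ∑ x, (T.degree x : ℝ) = 2 * T.edgeFinset.card := by
      exact_mod_cast T.sum_degrees_eq_twice_card_edges
    have h7 : (T.edgeFinset.card : ℝ) + 1 = Fintype.card V := by
      exact_mod_cast hT.2.card_edgeFinset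
    simp only [hT, if_true, h5, h6, ← h7]
    ring
  · simp [hT]

/-- In a `k`-regular equiarboreal graph the effective resistance across every edge is less than
`2 / k`. In terms of the Dirichlet form, where every edge is counted twice, this says that every
function with a nonzero difference across some edge has large energy. -/
theorem IsEquiarboreal.mul_sq_lt_dirichletForm [Fintype V] [DecidableRel G.Adj] {k : ℕ}
    (hG : G.Connected) (hreg : G.IsRegularOfDegree k) (heq : G.IsEquiarboreal) (huv : G.Adj u v)
    {f : V → ℝ} (hf : f u ≠ f v) :
    k * (f u - f v) ^ 2 < G.dirichletForm f f := by
  have h1 := two_mul_ncard_spanningTrees_mul_sq_le hG huv f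
  have h2 := heq.card_mul_ncard hreg huv
  have hpos : (0 : ℝ) < G.spanningTrees.ncard := by
    obtain ⟨T, hT⟩ := hG.exists_isTree_le
    exact_mod_cast (Set.ncard_pos (Set.toFinite _)).2 ⟨T, hT⟩
  have hn : (0 : ℝ) < Fintype.card V := by
    exact_mod_cast Fintype.card_pos_iff.2 ⟨u⟩
  set t : ℝ := (({T ∈ G.spanningTrees | s(u, v) ∈ T.edgeSet}.ncard : ℕ) : ℝ)
  set N : ℝ := (G.spanningTrees.ncard : ℝ)
  have h3 : k * t < 2 * N := by
    refine lt_of_mul_lt_mul_left ?_ hn.le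
    rw [h2]
    linarith
  have hd : 0 < (f u - f v) ^ 2 := by
    have := sub_ne_zero.2 hf
    positivity
  have ht : 0 ≤ t := Nat.cast_nonneg _
  have hE : 0 < G.dirichletForm f f := by
    by_contra! hE
    have := mul_nonpos_of_nonneg_of_nonpos ht hE
    have := mul_pos (mul_pos two_pos hpos) hd
    linarith
  refine lt_of_mul_lt_mul_left ?_ (mul_pos two_pos hpos).le
  calc 2 * N * (k * (f u - f v) ^ 2) = k * (2 * N * (f u - f v) ^ 2) := by ring
    _ ≤ k * (t * G.dirichletForm f f) := by gcongr
    _ = k * t * G.dirichletForm f f := by ring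
    _ < 2 * N * G.dirichletForm f f := by gcongr

/-! ### Edge cuts -/

open Classical in
/-- The edges of the cut between `A` and its complement, as ordered pairs with first entry
in `A`. -/
noncomputable def cutPairs [Fintype V] (G : SimpleGraph V) (A : Set V) : Finset (V × V) :=
  {q | q.1 ∈ A ∧ q.2 ∉ A ∧ G.Adj q.1 q.2}

theorem mem_cutPairs [Fintype V] {q : V × V} :
    q ∈ G.cutPairs A ↔ q.1 ∈ A ∧ q.2 ∉ A ∧ G.Adj q.1 q.2 := by
  simp [cutPairs]

theorem ncard_edgeCut [Fintype V] (G : SimpleGraph V) (A : Set V) :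
    (G.edgeCut A).ncard = (G.cutPairs A).card := by
  rw [← Set.ncard_coe_finset]
  symm
  refine Set.ncard_congr (fun q _ => s(q.1, q.2)) ?_ ?_ ?_
  · intro q hq
    obtain ⟨h1, h2, h3⟩ := mem_cutPairs.1 (Finset.mem_coe.1 hq)
    exact ⟨q.1, h1, q.2, h2, h3, rfl⟩
  · intro p q hp hq h
    obtain ⟨hp1, hp2, -⟩ := mem_cutPairs.1 (Finset.mem_coe.1 hp)
    obtain ⟨hq1, hq2, -⟩ := mem_cutPairs.1 (Finset.mem_coe.1 hq)
    rcases Sym2.eq_iff.1 h with ⟨h1, h2⟩ | ⟨h1, h2⟩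
    · exact Prod.ext h1 h2
    · exact absurd (h1 ▸ hp1) hq2
  · rintro e ⟨a, ha, b, hb, hab, rfl⟩
    exact ⟨(a, b), Finset.mem_coe.2 (mem_cutPairs.2 ⟨ha, hb, hab⟩), rfl⟩

theorem edgeCut_compl (G : SimpleGraph V) (A : Set V) : G.edgeCut Aᶜ = G.edgeCut A := by
  ext e
  constructor
  · rintro ⟨a, ha, b, hb, hab, rfl⟩
    exact ⟨b, not_not.1 hb, a, ha, hab.symm, Sym2.eq_swap⟩
  · rintro ⟨a, ha, b, hb, hab, rfl⟩
    exact ⟨b, hb, a, not_not.2 ha, hab.symm, Sym2.eq_swap⟩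

theorem Connected.cutPairs_nonempty [Fintype V] (hG : G.Connected) (hA : A.Nonempty)
    (hA' : Aᶜ.Nonempty) : (G.cutPairs A).Nonempty := by
  obtain ⟨a, ha⟩ := hA
  obtain ⟨b, hb⟩ := hA'
  obtain ⟨p⟩ := hG a b
  obtain ⟨d, -, h1, h2⟩ := p.exists_boundary_dart A ha hb
  exact ⟨d.toProd, mem_cutPairs.2 ⟨h1, h2, d.adj⟩⟩

/-! ### The Dirichlet form on test functions adapted to a cut -/

open Classical in
/-- The function which is `1` on `A` and `-1` on the complement of `A`. -/
noncomputable def signFun (A : Set V) (x : V) : ℝ := if x ∈ A then 1 else -1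

theorem dirichletForm_combination [Fintype V] (G : SimpleGraph V) (f g h : V → ℝ) (b c : ℝ) :
    G.dirichletForm (fun x => b * f x + c * (g x - h x)) (fun x => b * f x + c * (g x - h x)) =
      b ^ 2 * G.dirichletForm f f + c ^ 2 * (G.dirichletForm g g + G.dirichletForm h h -
        2 * G.dirichletForm g h) + 2 * b * c * (G.dirichletForm g f - G.dirichletForm h f) := by
  simp only [dirichletForm, mul_sub, mul_add, Finset.mul_sum, ← Finset.sum_add_distrib,
    ← Finset.sum_sub_distrib]
  refine Finset.sum_congr rfl fun x _ => Finset.sum_congr rfl fun y _ => ?_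
  split_ifs <;> ring

open Classical in
theorem dirichletForm_single [Fintype V] (G : SimpleGraph V) (u : V) (g : V → ℝ) :
    G.dirichletForm (Pi.single u 1) g = 2 * ∑ y, if G.Adj u y then g u - g y else 0 := by
  have h : ∀ x y, (if G.Adj x y then
      ((Pi.single u 1 : V → ℝ) x - (Pi.single u 1 : V → ℝ) y) * (g x - g y) else 0) =
      (if x = u then (if G.Adj u y then g u - g y else 0) else 0) +
      (if y = u then (if G.Adj u x then g u - g x else 0) else 0) := by
    intro x y
    rw [G.adj_comm x y]
    by_cases hx : x = u <;> by_cases hy : y = u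
    · subst hx; subst hy; simp
    · subst hx; simp [hy, G.adj_comm y x]
    · subst hy; simp [hx]
    · simp [hx, hy]
  simp only [dirichletForm, h, Finset.sum_add_distrib]
  rw [Finset.sum_comm]
  simp only [Finset.sum_ite_eq', Finset.mem_univ, if_true]
  ring

theorem dirichletForm_signFun [Fintype V] (G : SimpleGraph V) (A : Set V) :
    G.dirichletForm (signFun A) (signFun A) = 8 * (G.cutPairs A).card := by
  classical
  have h : ∀ x y, (if G.Adj x y then
      (signFun A x - signFun A y) * (signFun A x - signFun A y) else 0) =
      4 * (if x ∈ A ∧ y ∉ A ∧ G.Adj x y then (1 : ℝ) else 0) +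
      4 * (if y ∈ A ∧ x ∉ A ∧ G.Adj y x then (1 : ℝ) else 0) := by
    intro x y
    rw [G.adj_comm y x]
    by_cases hx : x ∈ A <;> by_cases hy : y ∈ A <;> by_cases hxy : G.Adj x y <;>
      simp [signFun, hx, hy, hxy] <;> norm_num
  have hc : ((G.cutPairs A).card : ℝ) =
      ∑ x, ∑ y, (if x ∈ A ∧ y ∉ A ∧ G.Adj x y then (1 : ℝ) else 0) := by
    rw [cutPairs, ← Finset.sum_boole, Fintype.sum_prod_type]
  simp only [dirichletForm, h, Finset.sum_add_distrib, ← Finset.mul_sum]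
  nth_rewrite 2 [Finset.sum_comm]
  rw [← hc]
  ring

open Classical in
theorem sum_adj_signFun_of_mem [Fintype V] (hu : u ∈ A) :
    ∑ y, (if G.Adj u y then signFun A u - signFun A y else 0) =
      2 * ((G.cutPairs A).filter (·.1 = u)).card := by
  have hc : (((G.cutPairs A).filter (·.1 = u)).card : ℝ) =
      ∑ y, (if y ∉ A ∧ G.Adj u y then (1 : ℝ) else 0) := by
    rw [cutPairs, Finset.filter_filter, ← Finset.sum_boole, Fintype.sum_prod_type,
      Finset.sum_eq_single u (fun x _ hx => Finset.sum_eq_zero fun y _ => if_neg fun h => hx h.2)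
        (by simp)]
    simp [hu]
  rw [hc, Finset.mul_sum]
  refine Finset.sum_congr rfl fun y _ => ?_
  by_cases hy : y ∈ A <;> by_cases h : G.Adj u y <;> simp [signFun, hu, hy, h]
  norm_num

open Classical in
theorem sum_adj_signFun_of_notMem [Fintype V] (hv : v ∉ A) :
    ∑ x, (if G.Adj v x then signFun A v - signFun A x else 0) =
      -2 * ((G.cutPairs A).filter (·.2 = v)).card := by
  have hc : (((G.cutPairs A).filter (·.2 = v)).card : ℝ) =
      ∑ x, (if x ∈ A ∧ G.Adj v x then (1 : ℝ) else 0) := by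
    rw [cutPairs, Finset.filter_filter, ← Finset.sum_boole, Fintype.sum_prod_type_right,
      Finset.sum_eq_single v (fun x _ hx => Finset.sum_eq_zero fun y _ => if_neg fun h => hx h.2)
        (by simp)]
    simp [hv, G.adj_comm v]
  rw [hc, Finset.mul_sum]
  refine Finset.sum_congr rfl fun y _ => ?_
  by_cases hy : y ∈ A <;> by_cases h : G.Adj v y <;> simp [signFun, hv, hy, h]
  norm_num

/-- Testing with the signed indicator function of `A`: every edge cut has more than `k / 2`
edges. -/
theorem IsEquiarboreal.lt_two_mul_card_cutPairs [Fintype V] [DecidableRel G.Adj]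
    (hG : G.Connected) (hreg : G.IsRegularOfDegree k) (heq : G.IsEquiarboreal)
    (hA : A.Nonempty) (hA' : Aᶜ.Nonempty) : k < 2 * (G.cutPairs A).card := by
  obtain ⟨⟨u, v⟩, h⟩ := hG.cutPairs_nonempty hA hA'
  obtain ⟨hu, hv, huv⟩ := mem_cutPairs.1 h
  have hfu : signFun A u = 1 := if_pos hu
  have hfv : signFun A v = -1 := if_neg hv
  have h1 := heq.mul_sq_lt_dirichletForm hG hreg huv (f := signFun A) (by rw [hfu, hfv]; norm_num)
  rw [dirichletForm_signFun, hfu, hfv] at h1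
  have h2 : (k : ℝ) < 2 * (G.cutPairs A).card := by linarith
  exact_mod_cast h2

/-! ### Pairs meeting two disjoint pairs -/

section Counting

variable {α β : Type*} [DecidableEq α] [DecidableEq β] (C : Finset (α × β))

theorem card_filter_fst_add_card_filter_snd_le (a : α) (b : β) :
    (C.filter (·.1 = a)).card + (C.filter (·.2 = b)).card ≤ C.card + 1 := by
  have h1 : ∑ q ∈ C, (if q = (a, b) then 1 else 0) ≤ 1 := by
    rw [Finset.sum_ite_eq']
    split_ifs <;> simp
  refine le_trans ?_ (Nat.add_le_add_left h1 _)
  rw [Finset.card_filter, Finset.card_filter, Finset.card_eq_sum_ones, ← Finset.sum_add_distrib,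
    ← Finset.sum_add_distrib]
  refine Finset.sum_le_sum fun q _ => ?_
  simp only [Prod.ext_iff]
  split_ifs <;> simp_all

/-- The pairs meeting two disjoint pairs `(a, b)` and `(a', b')` are counted at most once, apart from
the four pairs with both entries among `a`, `a'`, `b`, `b'`, which are counted twice. -/
theorem card_filter_add_four_le {a a' : α} {b b' : β} (ha : a ≠ a') (hb : b ≠ b') :
    (C.filter (·.1 = a)).card + (C.filter (·.2 = b)).card +
      ((C.filter (·.1 = a')).card + (C.filter (·.2 = b')).card) ≤ C.card + 4 := by
  have h1 : ∀ p : α × β, ∑ q ∈ C, (if q = p then 1 else 0) ≤ 1 := fun p => by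
    rw [Finset.sum_ite_eq']
    split_ifs <;> simp
  have h2 : (C.filter (·.1 = a)).card + (C.filter (·.2 = b)).card +
      ((C.filter (·.1 = a')).card + (C.filter (·.2 = b')).card) ≤
      C.card + (∑ q ∈ C, (if q = (a, b) then 1 else 0) + ∑ q ∈ C, (if q = (a, b') then 1 else 0) +
        (∑ q ∈ C, (if q = (a', b) then 1 else 0) +
          ∑ q ∈ C, (if q = (a', b') then 1 else 0))) := by
    simp only [Finset.card_filter, Finset.card_eq_sum_ones C, ← Finset.sum_add_distrib]
    refine Finset.sum_le_sum fun q _ => ?_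
    obtain ⟨x, y⟩ := q
    simp only [Prod.mk.injEq]
    by_cases h1 : x = a <;> by_cases h2 : x = a' <;> by_cases h3 : y = b <;>
      by_cases h4 : y = b' <;> simp_all
  have := h1 (a, b)
  have := h1 (a, b')
  have := h1 (a', b)
  have := h1 (a', b')
  omega

theorem exists_disjoint_or_star {α β : Type*} {C : Finset (α × β)} (hC : C.Nonempty) :
    (∃ p ∈ C, ∃ q ∈ C, p.1 ≠ q.1 ∧ p.2 ≠ q.2) ∨ (∃ a, ∀ q ∈ C, q.1 = a) ∨
      ∃ b, ∀ q ∈ C, q.2 = b := by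
  obtain ⟨⟨a, b⟩, h⟩ := hC
  by_contra! hn
  obtain ⟨h1, h2, h3⟩ := hn
  obtain ⟨p, hp, hpa⟩ := h2 a
  obtain ⟨q, hq, hqb⟩ := h3 b
  have e1 : b = p.2 := h1 _ h _ hp (Ne.symm hpa)
  have e2 : a = q.1 := by
    by_contra hne
    exact hqb (h1 _ h _ hq hne).symm
  exact hqb ((h1 _ hp _ hq (e2 ▸ hpa)).symm.trans e1.symm)

end Counting

/-! ### Nontrivial cuts -/

open Classical in
/-- For an edge `uv` of a cut, the test function is `1` at `u`, `-1` at `v`, and takes two opposite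
values on the rest of the two sides; optimizing the latter bounds from below the number of edges
of the cut at `u` and `v`. -/
theorem IsEquiarboreal.sq_lt_of_mem_cutPairs [Fintype V] [DecidableRel G.Adj]
    (hG : G.Connected) (hreg : G.IsRegularOfDegree k) (heq : G.IsEquiarboreal) (hk : 2 ≤ k)
    (h : (u, v) ∈ G.cutPairs A) {s : ℕ}
    (hs : ((G.cutPairs A).filter (·.1 = u)).card + ((G.cutPairs A).filter (·.2 = v)).card = s) :
    ((k : ℝ) + 1 - s) ^ 2 < 2 * ((G.cutPairs A).card - s) + k + 1 := by
  obtain ⟨hu, hv, huv⟩ := mem_cutPairs.1 h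
  simp only at hu hv huv
  have hsc : (s : ℝ) ≤ (G.cutPairs A).card + 1 := by
    rw [← hs]
    exact_mod_cast card_filter_fst_add_card_filter_snd_le (G.cutPairs A) u v
  have hk' : (2 : ℝ) ≤ k := by exact_mod_cast hk
  set c : ℝ := ((G.cutPairs A).card : ℝ) with hc
  have ha : 0 < 2 * (c - s) + k + 1 := by linarith
  set a : ℝ := 2 * (c - s) + k + 1 with ha'
  -- the minimum of the quadratic polynomial given by the energy
  set b : ℝ := (k + 1 - s) / a with hb
  have hab : a * b = k + 1 - s := by rw [hb]; field_simp
  set f : V → ℝ := fun x => b * signFun A x + (1 - b) *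
    ((Pi.single u 1 : V → ℝ) x - (Pi.single v 1 : V → ℝ) x) with hf
  have hfu : f u = 1 := by simp [hf, signFun, hu, huv.ne]
  have hfv : f v = -1 := by
    simp only [hf, signFun, if_neg hv, Pi.single_eq_same, Pi.single_eq_of_ne huv.ne.symm]
    ring
  have h1 := heq.mul_sq_lt_dirichletForm hG hreg huv (f := f) (by rw [hfu, hfv]; norm_num)
  have hself : ∀ w, G.dirichletForm (Pi.single w 1) (Pi.single w 1) = 2 * k := fun w => by
    rw [dirichletForm_single, ← sum_adj_eq hreg w]
    congr 1
    refine Finset.sum_congr rfl fun y _ => ?_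
    by_cases hy : G.Adj w y
    · simp [hy, hy.ne.symm]
    · simp [hy]
  have huv' : G.dirichletForm (Pi.single u 1) (Pi.single v 1) = -2 := by
    rw [dirichletForm_single, Finset.sum_eq_single v]
    · simp [huv, huv.ne]
    · intro y _ hy
      simp [hy, huv.ne]
    · simp
  rw [hf, dirichletForm_combination, dirichletForm_signFun, hself, hself, huv',
    dirichletForm_single, dirichletForm_single, sum_adj_signFun_of_mem hu,
    sum_adj_signFun_of_notMem hv, ← hf, hfu, hfv, ← hc] at h1
  have hs' : (((G.cutPairs A).filter (·.1 = u)).card : ℝ) +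
      ((G.cutPairs A).filter (·.2 = v)).card = s := by exact_mod_cast hs
  have h2 : 0 < 1 - b * (k + 1 - s) := by
    have e : 4 - 8 * b * (k + 1 - s) + 4 * b * (a * b) > 0 := by
      rw [ha']
      linear_combination h1 + 8 * b * (1 - b) * hs'
    rw [hab] at e
    linarith
  have h3 := mul_pos ha h2
  have h4 : a * (1 - b * (k + 1 - s)) = a - a * b * (k + 1 - s) := by ring
  rw [h4, hab] at h3
  linarith [sq ((k : ℝ) + 1 - s)]

open Classical in
theorem IsEquiarboreal.floor_lt_of_mem_cutPairs [Fintype V] [DecidableRel G.Adj]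
    (hG : G.Connected) (hreg : G.IsRegularOfDegree k) (heq : G.IsEquiarboreal) (hk : 2 ≤ k)
    (hc : (G.cutPairs A).card ≤ k) {q : V × V} (h : q ∈ G.cutPairs A) :
    ⌊(k : ℝ) - √(k : ℝ)⌋ < (((G.cutPairs A).filter (·.1 = q.1)).card +
      ((G.cutPairs A).filter (·.2 = q.2)).card : ℕ) := by
  have h1 := heq.sq_lt_of_mem_cutPairs hG hreg hk (u := q.1) (v := q.2) h rfl
  rw [Int.floor_lt, Int.cast_natCast]
  set s : ℕ := ((G.cutPairs A).filter (·.1 = q.1)).card + ((G.cutPairs A).filter (·.2 = q.2)).card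
  have hc' : ((G.cutPairs A).card : ℝ) ≤ k := by exact_mod_cast hc
  have h2 : ((k : ℝ) - s) ^ 2 < k := by nlinarith
  have := (Real.lt_sqrt_of_sq_lt h2)
  linarith

/-- A nontrivial cut is not a star: moving the centre `u` to the other side would leave two cuts with
`k` edges in total, of which each has more than `k / 2`. -/
theorem IsEquiarboreal.not_forall_cutPairs_fst_eq [Fintype V] [DecidableRel G.Adj]
    (hG : G.Connected) (hreg : G.IsRegularOfDegree k) (heq : G.IsEquiarboreal)
    (hA : A.Nontrivial) (hA' : Aᶜ.Nonempty) (u : V) : ¬ ∀ q ∈ G.cutPairs A, q.1 = u := by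
  classical
  intro hu
  obtain ⟨a, ha, hau⟩ := hA.exists_ne u
  have h1 := heq.lt_two_mul_card_cutPairs hG hreg hA.nonempty hA'
  have h2 := heq.lt_two_mul_card_cutPairs hG hreg (A := A \ {u}) ⟨a, ha, hau⟩ ⟨u, by simp⟩
  have h3 : (G.cutPairs A).card ≤ ((G.neighborFinset u).filter (· ∉ A)).card := by
    refine Finset.card_le_card_of_injOn Prod.snd ?_ ?_
    · intro q hq
      have hq := Finset.mem_coe.1 hq
      have hm := mem_cutPairs.1 hq
      rw [hu q hq] at hm
      simpa using ⟨hm.2.2, hm.2.1⟩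
    · intro p hp q hq h
      exact Prod.ext ((hu p hp).trans (hu q hq).symm) h
  have hsnd : ∀ q ∈ G.cutPairs (A \ {u}), q.2 = u := by
    intro q hq
    obtain ⟨⟨hq1, hq1'⟩, hq2, hq3⟩ := mem_cutPairs.1 hq
    by_contra hne
    exact hq1' (hu q (mem_cutPairs.2 ⟨hq1, fun h => hq2 ⟨h, hne⟩, hq3⟩))
  have h4 : (G.cutPairs (A \ {u})).card ≤ ((G.neighborFinset u).filter (¬ · ∉ A)).card := by
    refine Finset.card_le_card_of_injOn Prod.fst ?_ ?_
    · intro q hq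
      have hq := Finset.mem_coe.1 hq
      have hm := mem_cutPairs.1 hq
      rw [hsnd q hq] at hm
      simpa using ⟨hm.2.2.symm, hm.1.1⟩
    · intro p hp q hq h
      exact Prod.ext h ((hsnd p hp).trans (hsnd q hq).symm)
  have h5 := Finset.card_filter_add_card_filter_not (s := G.neighborFinset u) (· ∉ A)
  rw [card_neighborFinset_eq_degree, hreg u] at h5
  omega

theorem IsEquiarboreal.two_mul_floor_sub_two_le [Fintype V] [DecidableRel G.Adj]
    (hG : G.Connected) (hreg : G.IsRegularOfDegree k) (heq : G.IsEquiarboreal) (hk : 2 ≤ k)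
    (hA : A.Nontrivial) (hA' : Aᶜ.Nontrivial) (hc : (G.cutPairs A).card ≤ k) :
    2 * ⌊(k : ℝ) - √(k : ℝ)⌋ - 2 ≤ ((G.cutPairs A).card : ℤ) := by
  classical
  rcases exists_disjoint_or_star (hG.cutPairs_nonempty hA.nonempty hA'.nonempty) with
    ⟨p, hp, q, hq, h1, h2⟩ | ⟨u, hu⟩ | ⟨v, hv⟩
  · have h3 := heq.floor_lt_of_mem_cutPairs hG hreg hk hc hp
    have h4 := heq.floor_lt_of_mem_cutPairs hG hreg hk hc hq
    have h5 := card_filter_add_four_le (G.cutPairs A) h1 h2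
    omega
  · exact absurd hu (heq.not_forall_cutPairs_fst_eq hG hreg hA hA'.nonempty u)
  · refine absurd (fun q hq => ?_) (heq.not_forall_cutPairs_fst_eq hG hreg hA'
      (by rw [compl_compl]; exact hA.nonempty) v)
    obtain ⟨h1, h2, h3⟩ := mem_cutPairs.1 hq
    exact hv (q.2, q.1) (mem_cutPairs.2 ⟨not_not.1 h2, h1, h3.symm⟩)

theorem IsRegularOfDegree.card_cutPairs_singleton [Fintype V] [DecidableRel G.Adj]
    (hreg : G.IsRegularOfDegree k) (u : V) : (G.cutPairs {u}).card = k := by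
  classical
  rw [← hreg u, ← card_neighborFinset_eq_degree]
  refine Finset.card_bij (fun q _ => q.2) ?_ ?_ ?_
  · rintro ⟨a, b⟩ hq
    obtain ⟨h1, h2, h3⟩ := mem_cutPairs.1 hq
    obtain rfl : a = u := h1
    simpa using h3
  · rintro p hp q hq h
    exact Prod.ext ((mem_cutPairs.1 hp).1.trans (mem_cutPairs.1 hq).1.symm) h
  · intro b hb
    have hb' : G.Adj u b := by simpa using hb
    exact ⟨(u, b), mem_cutPairs.2 ⟨rfl, hb'.ne.symm, hb'⟩, rfl⟩

/-! ### Numerical estimates -/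

theorem le_floor_sub_sqrt {k m j : ℕ} (hmj : m + j = k) (hj : k ≤ j ^ 2) :
    (m : ℤ) ≤ ⌊(k : ℝ) - √(k : ℝ)⌋ := by
  rw [Int.le_floor, Int.cast_natCast]
  have h1 : √(k : ℝ) ≤ j := Real.sqrt_le_iff.2 ⟨by positivity, by exact_mod_cast hj⟩
  have h2 : (m : ℝ) + j = k := by exact_mod_cast hmj
  linarith

/-- The bound of the floor by `k - j` is sharp enough for `j = ⌊k / 2⌋ - 1`, whose square is at least
`k` if `k ≥ 8`. -/
theorem add_two_le_two_mul_floor {k : ℕ} (hk : 8 ≤ k) :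
    (k : ℤ) + 2 ≤ 2 * ⌊(k : ℝ) - √(k : ℝ)⌋ := by
  obtain ⟨i, hi⟩ : ∃ i, k / 2 = i + 4 := ⟨k / 2 - 4, by omega⟩
  have h := le_floor_sub_sqrt (k := k) (m := k - (i + 3)) (j := i + 3) (by omega)
    (by nlinarith [Nat.div_add_mod k 2, Nat.mod_lt k two_pos])
  omega

theorem add_two_lt_two_mul_floor {k : ℕ} (hk : 11 ≤ k) :
    (k : ℤ) + 2 < 2 * ⌊(k : ℝ) - √(k : ℝ)⌋ := by
  rcases Nat.even_or_odd' k with ⟨i, rfl | rfl⟩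
  · obtain ⟨l, rfl⟩ : ∃ l, i = l + 6 := ⟨i - 6, by omega⟩
    have h := le_floor_sub_sqrt (k := 2 * (l + 6)) (m := l + 8) (j := l + 4) (by omega)
      (by nlinarith)
    omega
  · obtain ⟨l, rfl⟩ : ∃ l, i = l + 5 := ⟨i - 5, by omega⟩
    have h := le_floor_sub_sqrt (k := 2 * (l + 5) + 1) (m := l + 7) (j := l + 4) (by omega)
      (by nlinarith)
    omega

end SimpleGraph


theorem theorem3p15 {V : Type*} [Fintype V] (G : SimpleGraph V) [DecidableRel G.Adj] (k : ℕ)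
    (hk : 8 ≤ k) (hconn : G.Connected) (hreg : G.IsRegularOfDegree k) (heq : G.IsEquiarboreal) :
    G.edgeConnectivity = k ∧
    (11 ≤ k → ∀ C : Set (Sym2 V), G.IsEdgeCut C → C.ncard = k → ¬ G.IsNontrivialEdgeCut C) ∧
    (∀ C : Set (Sym2 V), G.IsNontrivialEdgeCut C → C.ncard ≤ k →
      2 * ⌊(k : ℝ) - √(k : ℝ)⌋ - 2 ≤ (C.ncard : ℤ)) := by
  have key : ∀ C : Set (Sym2 V), G.IsNontrivialEdgeCut C → C.ncard ≤ k →
      2 * ⌊(k : ℝ) - √(k : ℝ)⌋ - 2 ≤ (C.ncard : ℤ) := by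
    rintro C ⟨A, hA, hA', rfl⟩ hc
    rw [SimpleGraph.ncard_edgeCut] at hc ⊢
    exact heq.two_mul_floor_sub_two_le hconn hreg (by omega) hA hA' hc
  refine ⟨?_, fun hk' C _ hc hC => ?_, key⟩
  · have hsingle : ∀ u, (G.edgeCut {u}).ncard = k := fun u => by
      rw [SimpleGraph.ncard_edgeCut, hreg.card_cutPairs_singleton]
    rw [SimpleGraph.edgeConnectivity]
    refine IsLeast.csInf_eq ⟨?_, ?_⟩
    · obtain ⟨u⟩ := hconn.nonempty
      obtain ⟨w, hw⟩ := (G.degree_pos_iff_exists_adj u).1 (by rw [hreg u]; omega)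
      exact ⟨_, ⟨{u}, ⟨u, rfl⟩, ⟨w, hw.ne.symm⟩, rfl⟩, hsingle u⟩
    · rintro n ⟨C, ⟨A, hA, hA', rfl⟩, rfl⟩
      rcases hA.exists_eq_singleton_or_nontrivial with ⟨u, rfl⟩ | hA
      · exact (hsingle u).ge
      rcases hA'.exists_eq_singleton_or_nontrivial with ⟨u, hu⟩ | hA'
      · rw [← SimpleGraph.edgeCut_compl, hu]
        exact (hsingle u).ge
      by_contra! hlt
      have h1 := key _ ⟨A, hA, hA', rfl⟩ hlt.le
      have h2 := SimpleGraph.add_two_le_two_mul_floor hk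
      omega
  · have h1 := key C hC hc.le
    have h2 := SimpleGraph.add_two_lt_two_mul_floor hk'
    omega
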